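/- Let $\mathcal{C}$ be a small category with a terminal object $1$ such that every object of $\mathcal{C}$ has a point (a map from $1$). Let $p : \mathrm{Psh}(\mathcal{C}) \to \mathbf{Set}$ be the canonical geometric morphism from the topos of presheaves on $\mathcal{C}$: $p^*$ sends a set to the constant presheaf, $p_* X = X(1)$, and $p_*$ has the fully faithful right adjoint $p^!$ given by $(p^! A)(C) = A^{\mathcal{C}(1,C)}$, so that $p$ is local. Terminology. A local geometric morphism $q$ is a *quality type* if the canonical transformation $\phi : q^* \to q^!$ is an isomorphism; it is *pre-cohesive* if $\phi$ is monic and $q^*$ has a left adjoint that preserves finite products. A subtopos $k$ is *above* a subtopos $j$ (of the same topos) if $j_*$ factors, up to isomorphism, through $k_*$; the order of subtoposes (smaller, larger, largest) is this one. The *centre* of a local $q : \mathcal{E} \to \mathcal{S}$ is the subtopos $q_* \dashv q^! : \mathcal{S} \to \mathcal{E}$. A *subquality* of $q$ is a subtopos $j : \mathcal{E}_j \to \mathcal{E}$ that is above the centre of $q$ and such that the composite $q j : \mathcal{E}_j \to \mathcal{S}$ is a quality type. It is *essential* if $j^*$ has a left adjoint. *Level $\epsilon$* of $q$, if it exists,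 is the largest essential subquality of $q$. A map $f : D \to C$ in $\mathcal{C}$ is a *pseudo-constant* if $f a = f b$ for all points $a, b : 1 \to D$. A class of maps of $\mathcal{C}$ is an *idempotent ideal* if it is closed under composition, on either side, with arbitrary maps of $\mathcal{C}$, and each of its members is a composite of two of its members. **Proposition.** Suppose that the pseudo-constants of $\mathcal{C}$ form an idempotent ideal. Then the sieves $S$ on objects $C$ such that $S$ contains all the pseudo-constants with codomain $C$ are the covering sieves of a Grothendieck topology $J$ on $\mathcal{C}$. The geometric morphism $p$ is pre-cohesive and has a level $\epsilon$, namely the subtopos $\mathrm{Sh}(\mathcal{C}, J) \to \mathrm{Psh}(\mathcal{C})$, and this subtopos is also the largest subquality of $p$. -/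

import Mathlib

open CategoryTheory CategoryTheory.Limits Opposite

universe w v u v₁ v₂ v₃ u₁ u₂ u₃

namespace LevelEpsilon

noncomputable section

/-! ## Geometric morphisms -/

/-- A geometric morphism `f : F → E`: a direct image `f_* : F ⥤ E` together with a left adjoint
inverse image `f^* : E ⥤ F` that preserves finite limits. -/
structure GeometricMorphism (F : Type u₁) [Category.{v₁} F] (E : Type u₂) [Category.{v₂} E] where
  /-- the direct image `f_*` -/
  direct : F ⥤ E
  /-- the inverse image `f^*` -/
  inverse : E ⥤ F
  /-- the adjunction `f^* ⊣ f_*` -/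
  adj : inverse ⊣ direct
  lex : PreservesFiniteLimits inverse

namespace GeometricMorphism

variable {D : Type u₁} [Category.{v₁} D] {E : Type u₂} [Category.{v₂} E]
  {S : Type u₃} [Category.{v₃} S]

/-- The composite `D → E → S` of two geometric morphisms. -/
def comp (j : GeometricMorphism D E) (p : GeometricMorphism E S) : GeometricMorphism D S where
  direct := j.direct ⋙ p.direct
  inverse := p.inverse ⋙ j.inverse
  adj := p.adj.comp j.adj
  lex := by
    have := j.lex
    have := p.lex
    exact comp_preservesFiniteLimits _ _

/-- `j : D → E` exhibits `D` as a subtopos of `E`: its direct image is full and faithful.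
(When `E` is a topos, a category `D` with such a `j` is automatically a topos.) -/
structure IsSubtopos (j : GeometricMorphism D E) : Prop where
  full : j.direct.Full
  faithful : j.direct.Faithful

/-- `j` is essential: its inverse image has a left adjoint `j_!`. -/
def IsEssential (j : GeometricMorphism D E) : Prop := j.inverse.IsRightAdjoint

/-- For subtoposes `k : D → E` and `j : S → E`, `k` is above `j`: the direct image `j_*` factors,
up to isomorphism, through `k_*`. -/
def IsAbove (k : GeometricMorphism D E) (j : GeometricMorphism S E) : Prop :=
  ∃ h : S ⥤ D, Nonempty (h ⋙ k.direct ≅ j.direct)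

end GeometricMorphism

/-! ## Local geometric morphisms -/

/-- A local geometric morphism `p : E → S`: the direct image `p_*` has a full and faithful right
adjoint `p^!`. -/
structure LocalGeometricMorphism (E : Type u₁) [Category.{v₁} E] (S : Type u₂) [Category.{v₂} S]
    extends GeometricMorphism E S where
  /-- the right adjoint `p^!` of `p_*` -/
  coinverse : S ⥤ E
  /-- the adjunction `p_* ⊣ p^!` -/
  coadj : direct ⊣ coinverse
  coinverse_full : coinverse.Full
  coinverse_faithful : coinverse.Faithful

namespace LocalGeometricMorphism

variable {E : Type u₁} [Category.{v₁} E] {S : Type u₂} [Category.{v₂} S]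

/-- The centre of `p` ("level 0"): the subtopos `p_* ⊣ p^! : S → E`. -/
def centre (p : LocalGeometricMorphism E S) : GeometricMorphism S E where
  direct := p.coinverse
  inverse := p.direct
  adj := p.coadj
  lex := by
    have := p.adj.rightAdjoint_preservesLimits
    infer_instance

/-- The adjoint triple `p^* ⊣ p_* ⊣ p^!`. -/
def triple (p : LocalGeometricMorphism E S) :
    Adjunction.Triple p.inverse p.direct p.coinverse where
  adj₁ := p.adj
  adj₂ := p.coadj

/-- As `p^!` is full and faithful, so is `p^*`. -/
def inverseFullyFaithful (p : LocalGeometricMorphism E S) : p.inverse.FullyFaithful :=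
  have := p.coinverse_full
  have := p.coinverse_faithful
  p.triple.fullyFaithfulEquiv.symm (Functor.FullyFaithful.ofFullyFaithful p.coinverse)

/-- The canonical transformation `φ : p^* ⟶ p^!`, that is, the unit `p^* ⟶ p^! p_* p^*` of
`p_* ⊣ p^!` at `p^*`, followed by `p^!` of the inverse of the unit `1 ⟶ p_* p^*` of `p^* ⊣ p_*`. -/
def phi (p : LocalGeometricMorphism E S) : p.inverse ⟶ p.coinverse :=
  have := p.coinverse_full
  have := p.coinverse_faithful
  have := p.inverseFullyFaithful.full
  have := p.inverseFullyFaithful.faithful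
  p.triple.leftToRight

/-- A local geometric morphism `q` is a quality type if `φ : q^* ⟶ q^!` is an isomorphism. -/
def IsQualityType (q : LocalGeometricMorphism E S) : Prop := IsIso q.phi

/-- A local geometric morphism `p` is pre-cohesive if `p^*` has a left adjoint `p_!` that
preserves finite products, and the Nullstellensatz holds: `φ : p^* ⟶ p^!` is monic. -/
def IsPreCohesive (p : LocalGeometricMorphism E S) : Prop :=
  (∃ pieces : E ⥤ S, Nonempty (pieces ⊣ p.inverse) ∧ PreservesFiniteProducts pieces) ∧
    ∀ A : S, Mono (p.phi.app A)

end LocalGeometricMorphism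

/-! ## Subqualities and level ε -/

section

variable {E : Type u₁} [Category.{v₁} E] {S : Type u₂} [Category.{v₂} S]
  {D : Type u₃} [Category.{v₃} D]

/-- A subquality of the local geometric morphism `p : E → S` is a subtopos `j : D → E` above the
centre of `p` such that the composite `p j : D → S` is (local and) a quality type.
(The right adjoint of the direct image of `p j` is unique up to isomorphism, so that the choice
of it in `q` does not matter.) -/
structure IsSubquality (p : LocalGeometricMorphism E S) (j : GeometricMorphism D E) : Prop where
  isSubtopos : j.IsSubtopos
  isAbove_centre : j.IsAbove p.centre
  isQualityType : ∃ q : LocalGeometricMorphism D S,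
    q.toGeometricMorphism = j.comp p.toGeometricMorphism ∧ q.IsQualityType

/-- `j` is the largest subquality of `p`: it is a subquality that is above every subquality of `p`
(given by a category with objects in `Type w` and morphisms in `Type v`). -/
structure IsLargestSubquality (p : LocalGeometricMorphism E S) (j : GeometricMorphism D E) :
    Prop where
  isSubquality : IsSubquality p j
  isAbove : ∀ {D' : Type w} [Category.{v} D'] (k : GeometricMorphism D' E),
    IsSubquality p k → j.IsAbove k

/-- `j` is level `ε` of `p`: it is an essential subquality that is above every essential
subquality of `p` (given by a category with objects in `Type w` and morphisms in `Type v`). -/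
structure IsLevelEpsilon (p : LocalGeometricMorphism E S) (j : GeometricMorphism D E) :
    Prop where
  isSubquality : IsSubquality p j
  isEssential : j.IsEssential
  isAbove : ∀ {D' : Type w} [Category.{v} D'] (k : GeometricMorphism D' E),
    IsSubquality p k → k.IsEssential → j.IsAbove k

end

/-! ## Idempotent ideals -/

/-- A class `I` of maps is an idempotent ideal if it is closed under composition with arbitrary
maps on both sides, and every map in `I` is a composite of two maps in `I`. -/
structure IsIdempotentIdeal {C : Type u} [Category.{v} C] (I : MorphismProperty C) : Prop where
  precomp : ∀ {X Y Z : C} (h : X ⟶ Y) (g : Y ⟶ Z), I g → I (h ≫ g)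
  postcomp : ∀ {X Y Z : C} (g : X ⟶ Y) (f : Y ⟶ Z), I g → I (g ≫ f)
  idempotent : ∀ {X Z : C} (f : X ⟶ Z), I f →
    ∃ (Y : C) (h : X ⟶ Y) (g : Y ⟶ Z), I h ∧ I g ∧ h ≫ g = f

/-- The Grothendieck topology of an idempotent ideal `I`: a sieve on `X` is covering iff it
contains all the maps in `I` with codomain `X`. -/
def IsIdempotentIdeal.topology {C : Type u} [Category.{v} C] {I : MorphismProperty C}
    (hI : IsIdempotentIdeal I) : GrothendieckTopology C where
  sieves X := {T | ∀ ⦃Y : C⦄ (f : Y ⟶ X), I f → T f}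
  top_mem' _ _ _ _ := trivial
  pullback_stable' _ _ _ f hT _ g hg := hT (g ≫ f) (hI.postcomp g f hg)
  transitive' _ _ hT R hR _ f hf := by
    obtain ⟨Z, h, g, hh, hg, rfl⟩ := hI.idempotent f hf
    exact hR (hT g hg) h hh

/-! ## Presheaf toposes -/

/-- The subtopos `Sh(C, J) → Psh(C)`: inclusion of sheaves and sheafification. -/
def sheafSubtopos {C : Type u} [SmallCategory C] (J : GrothendieckTopology C) :
    GeometricMorphism (Sheaf J (Type u)) (Cᵒᵖ ⥤ Type u) where
  direct := sheafToPresheaf J (Type u)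
  inverse := presheafToSheaf J (Type u)
  adj := sheafificationAdjunction J (Type u)
  lex := inferInstance

section

variable (C : Type u) [SmallCategory C] [HasTerminal C]

/-- The class of pseudo-constants: the maps `f : X ⟶ Y` such that any two points `a b : 1 ⟶ X`
become equal after composition with `f`. -/
def pseudoConstants : MorphismProperty C :=
  fun X _ f => ∀ a b : ⊤_ C ⟶ X, a ≫ f = b ≫ f

/-- The adjunction `p^* ⊣ p_*` between the constant presheaf functor and evaluation at `1`. -/
def constEvAdj :
    Functor.const Cᵒᵖ ⊣ (evaluation Cᵒᵖ (Type u)).obj (op (⊤_ C)) :=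
  Adjunction.mkOfUnitCounit
    { unit := { app := fun A => 𝟙 A }
      counit :=
        { app := fun P =>
            { app := fun X => P.map (terminal.from X.unop).op
              naturality := fun X Y f => by
                have h : (terminal.from X.unop).op ≫ f = (terminal.from Y.unop).op :=
                  Quiver.Hom.unop_inj (Subsingleton.elim _ _)
                simp [← h] }
          naturality := fun P Q g => by ext X x; simp }
      left_triangle := by ext A X x; simp
      right_triangle := by
        ext P x
        have h : (terminal.from (⊤_ C)).op = 𝟙 (op (⊤_ C)) :=
          Quiver.Hom.unop_inj (Subsingleton.elim _ _)
        simp [h] }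

/-- The functor `p^!` sending a set `A` to the presheaf `X ↦ (C(1, X) → A)`. -/
def coconst : Type u ⥤ (Cᵒᵖ ⥤ Type u) where
  obj A :=
    { obj := fun X => (⊤_ C ⟶ X.unop) → A
      map := fun f => ↾fun s a => s (a ≫ f.unop)
      map_id := fun X => by
        ext s a
        exact congrArg s (Category.comp_id a)
      map_comp := fun f g => by
        ext s a
        exact congrArg s (Category.assoc a g.unop f.unop).symm }
  map t :=
    { app := fun X => ↾fun s a => t (s a)
      naturality := fun X Y f => by ext s; rfl }
  map_id A := by ext X s; rfl
  map_comp f g := by ext X s; rfl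

/-- The adjunction `p_* ⊣ p^!`. -/
def evCoconstAdj : (evaluation Cᵒᵖ (Type u)).obj (op (⊤_ C)) ⊣ coconst C :=
  Adjunction.mkOfUnitCounit
    { unit :=
        { app := fun P =>
            { app := fun X => ↾fun x (a : ⊤_ C ⟶ X.unop) => P.map a.op x
              naturality := fun X Y f => by ext x; funext a; simp [coconst] }
          naturality := fun P Q g => by
            ext X x; funext a; simp [coconst, NatTrans.naturality_apply] }
      counit :=
        { app := fun A => ↾fun (s : (⊤_ C ⟶ ⊤_ C) → A) => s (𝟙 _)
          naturality := fun A B t => by ext s; rfl }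
      left_triangle := by
        ext P x
        exact congrArg (fun f => f x) (P.map_id (op (⊤_ C)))
      right_triangle := by
        ext A X s
        exact funext fun a => congrArg s (Category.id_comp a) }

/-- The counit `p_* p^! ⟶ 1` is an isomorphism, as `1` has exactly one point. -/
theorem isIso_evCoconstAdj_counit : IsIso (evCoconstAdj C).counit := by
  have h (A : Type u) : IsIso ((evCoconstAdj C).counit.app A) := by
    refine ⟨↾fun (x : A) (_ : ⊤_ C ⟶ ⊤_ C) => x, ?_, ?_⟩
    · ext s
      funext a
      exact congrArg s (Subsingleton.elim _ _)
    · ext x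
      rfl
  exact NatIso.isIso_of_isIso_app _

/-- The canonical geometric morphism `p : Psh(C) → Set`: `p^*` sends a set to the constant
presheaf, `p_*` sends a presheaf `P` to its set `P(1)` of global sections, and `p^!` sends a set
`A` to `X ↦ A ^ C(1, X)`. It is local because `C` has a terminal object. -/
def presheafToSet : LocalGeometricMorphism (Cᵒᵖ ⥤ Type u) (Type u) where
  direct := (evaluation Cᵒᵖ (Type u)).obj (op (⊤_ C))
  inverse := Functor.const Cᵒᵖ
  adj := constEvAdj C
  lex := inferInstance
  coinverse := coconst C
  coadj := evCoconstAdj C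
  coinverse_full :=
    have := isIso_evCoconstAdj_counit C
    (evCoconstAdj C).fullyFaithfulROfIsIsoCounit.full
  coinverse_faithful :=
    have := isIso_evCoconstAdj_counit C
    (evCoconstAdj C).fullyFaithfulROfIsIsoCounit.faithful

end

end

end LevelEpsilon

namespace LevelEpsilon

section Sifted

variable {C : Type u} [Category.{v} C] [HasTerminal C]

/-- The opposite of a category with a terminal object in which every object has a point is
sifted. -/
theorem isSifted_op_of_nonempty_points (hpoint : ∀ X : C, Nonempty (⊤_ C ⟶ X)) :
    IsSifted Cᵒᵖ := by
  have : Nonempty Cᵒᵖ := ⟨op (⊤_ C)⟩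
  have hfinal : (Functor.diag Cᵒᵖ).Final := by
    refine ⟨fun ⟨X, Y⟩ => ?_⟩
    let span (Z : C) (f : Z ⟶ X.unop) (g : Z ⟶ Y.unop) :
        StructuredArrow (X, Y) (Functor.diag Cᵒᵖ) :=
      StructuredArrow.mk (Y := op Z) (f := (⟨f.op, g.op⟩ : (X, Y) ⟶ (Functor.diag Cᵒᵖ).obj (op Z)))
    have hzag {Z W : C} (h : W ⟶ Z) (f : Z ⟶ X.unop) (g : Z ⟶ Y.unop) (f' : W ⟶ X.unop)
        (g' : W ⟶ Y.unop) (hf : h ≫ f = f') (hg : h ≫ g = g') :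
        Zigzag (span Z f g) (span W f' g') := by
      subst hf hg
      exact Zigzag.of_hom (StructuredArrow.homMk h.op rfl)
    have hleft (a a' : ⊤_ C ⟶ X.unop) (b : ⊤_ C ⟶ Y.unop) :
        Zigzag (span _ a b) (span _ a' b) :=
      (hzag a (𝟙 _) (terminal.from _ ≫ b) a b (by simp)
        (by rw [← Category.assoc, Subsingleton.elim (a ≫ _) (𝟙 _), Category.id_comp])).symm.trans
      (hzag a' (𝟙 _) (terminal.from _ ≫ b) a' b (by simp)
        (by rw [← Category.assoc, Subsingleton.elim (a' ≫ _) (𝟙 _), Category.id_comp]))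
    have hright (a : ⊤_ C ⟶ X.unop) (b b' : ⊤_ C ⟶ Y.unop) :
        Zigzag (span _ a b) (span _ a b') :=
      (hzag b (terminal.from _ ≫ a) (𝟙 _) a b
        (by rw [← Category.assoc, Subsingleton.elim (b ≫ _) (𝟙 _), Category.id_comp])
        (by simp)).symm.trans
      (hzag b' (terminal.from _ ≫ a) (𝟙 _) a b'
        (by rw [← Category.assoc, Subsingleton.elim (b' ≫ _) (𝟙 _), Category.id_comp]) (by simp))
    obtain ⟨a₀⟩ := hpoint X.unop
    obtain ⟨b₀⟩ := hpoint Y.unop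
    have : Nonempty (StructuredArrow (X, Y) (Functor.diag Cᵒᵖ)) := ⟨span _ a₀ b₀⟩
    have hbase (s : StructuredArrow (X, Y) (Functor.diag Cᵒᵖ)) : Zigzag s (span _ a₀ b₀) := by
      obtain ⟨z⟩ := hpoint s.right.unop
      exact (hzag z s.hom.1.unop s.hom.2.unop _ _ rfl rfl).trans
        ((hleft _ a₀ _).trans (hright _ _ b₀))
    exact zigzag_isConnected fun s t => (hbase s).trans (hbase t).symm
  constructor

end Sifted

section PreCohesive

variable {C : Type u} [SmallCategory C] [HasTerminal C]

theorem isPreCohesive_presheafToSet (hpoint : ∀ X : C, Nonempty (⊤_ C ⟶ X)) :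
    (presheafToSet C).IsPreCohesive := by
  have := isSifted_op_of_nonempty_points hpoint
  refine ⟨⟨colim, ⟨colimConstAdj⟩, inferInstance⟩, fun A => ?_⟩
  have := (presheafToSet C).coinverse_full
  have := (presheafToSet C).coinverse_faithful
  have := (presheafToSet C).inverseFullyFaithful.full
  have := (presheafToSet C).inverseFullyFaithful.faithful
  refine (presheafToSet C).triple.mono_leftToRight_app_iff_mono_adj₂_unit_app.2 ?_
  have (X : Cᵒᵖ) : Mono (((evCoconstAdj C).unit.app ((Functor.const Cᵒᵖ).obj A)).app X) := by
    rw [mono_iff_injective]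
    intro x y h
    obtain ⟨a⟩ := hpoint X.unop
    exact congrFun h a
  exact NatTrans.mono_of_mono_app ((evCoconstAdj C).unit.app ((Functor.const Cᵒᵖ).obj A))

end PreCohesive

namespace LocalGeometricMorphism

variable {E : Type u₁} [Category.{v₁} E] {S : Type u₂} [Category.{v₂} S]

/-- A local geometric morphism is a quality type as soon as the objects `q^* A` lie in the
essential image of `q^!`. -/
theorem isQualityType_of_mem_essImage (q : LocalGeometricMorphism E S)
    (h : ∀ A : S, q.coinverse.essImage (q.inverse.obj A)) : q.IsQualityType := by
  have := q.coinverse_full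
  have := q.coinverse_faithful
  have := q.inverseFullyFaithful.full
  have := q.inverseFullyFaithful.faithful
  have (A : S) : IsIso (q.phi.app A) := by
    have : IsIso (q.triple.adj₂.unit.app (q.inverse.obj A)) :=
      (q.coadj.isIso_unit_app_iff_mem_essImage).2 (h A)
    have h' : q.phi.app A = q.triple.adj₂.unit.app (q.inverse.obj A) ≫
        inv (q.coinverse.map (q.triple.adj₁.unit.app A)) := q.triple.leftToRight_app
    rw [h']
    infer_instance
  exact NatIso.isIso_of_isIso_app _

end LocalGeometricMorphism

variable {C : Type u} [SmallCategory C] [HasTerminal C]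

/-- The presheaves `p^! A` are sheaves for every topology whose covering sieves contain all
points. -/
theorem isSheaf_coconst {J : GrothendieckTopology C}
    (hJ : ∀ ⦃X : C⦄ (S : Sieve X), S ∈ J X → ∀ a : ⊤_ C ⟶ X, S a) (A : Type u) :
    Presheaf.IsSheaf J ((coconst C).obj A) := by
  rw [isSheaf_iff_isSheaf_of_type]
  intro X S hS x hx
  have hx' := hx.to_sieveCompatible
  refine ⟨fun a => x a (hJ S hS a) (𝟙 _), fun Y f hf => ?_, fun t ht => ?_⟩
  · funext b
    refine (congrFun (hx' f b hf) (𝟙 _)).trans ?_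
    exact congrArg (x f hf) (Category.id_comp b)
  · funext a
    refine Eq.trans ?_ (congrFun (ht a (hJ S hS a)) (𝟙 _))
    exact congrArg t (Category.id_comp a).symm

/-- The composite `Sh(C, J) → Psh(C) → Set` is local if the presheaves `p^! A` are sheaves. -/
noncomputable def sheafToSet {J : GrothendieckTopology C}
    (hJ : ∀ A : Type u, Presheaf.IsSheaf J ((coconst C).obj A)) :
    LocalGeometricMorphism (Sheaf J (Type u)) (Type u) where
  toGeometricMorphism := (sheafSubtopos J).comp (presheafToSet C).toGeometricMorphism
  coinverse := ObjectProperty.lift _ (coconst C) hJ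
  coadj := (evCoconstAdj C).restrictFullyFaithful (fullyFaithfulSheafToPresheaf J (Type u))
    (Functor.FullyFaithful.id _) (Iso.refl _) (Iso.refl _)
  coinverse_full :=
    have := (presheafToSet C).coinverse_full
    have : (coconst C).Full := this
    inferInstance
  coinverse_faithful :=
    have := (presheafToSet C).coinverse_faithful
    have : (coconst C).Faithful := this
    inferInstance

/-- If every pseudo-constant sieve is covering, the unit `p^* A ⟶ p^! A` is inverted by
sheafification. -/
theorem W_evCoconstAdj_unit_const (hpoint : ∀ X : C, Nonempty (⊤_ C ⟶ X))
    {J : GrothendieckTopology C}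
    (hJ : ∀ ⦃X : C⦄ (S : Sieve X), (∀ ⦃Y : C⦄ (f : Y ⟶ X), pseudoConstants C f → S f) → S ∈ J X)
    (A : Type u) : J.W ((evCoconstAdj C).unit.app ((Functor.const Cᵒᵖ).obj A)) := by
  rw [J.W_iff_isLocallyBijective]
  refine ⟨⟨fun {X} x y h => ?_⟩, ⟨fun {X} s => ?_⟩⟩
  · obtain ⟨a⟩ := hpoint X.unop
    obtain rfl : x = y := congrFun h a
    simp
  · refine hJ _ fun Y f hf => ?_
    obtain ⟨a⟩ := hpoint Y
    exact ⟨(s : (⊤_ C ⟶ X) → A) (a ≫ f), funext fun b => congrArg s (hf a b)⟩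

theorem isSubquality_sheafSubtopos (hpoint : ∀ X : C, Nonempty (⊤_ C ⟶ X))
    (hI : IsIdempotentIdeal (pseudoConstants C)) :
    IsSubquality (presheafToSet C) (sheafSubtopos hI.topology) := by
  have hsheaf (A : Type u) : Presheaf.IsSheaf hI.topology ((coconst C).obj A) :=
    isSheaf_coconst (J := hI.topology) (fun X S hS a => hS a fun b c => by rw [Subsingleton.elim b c]) A
  refine ⟨⟨(fullyFaithfulSheafToPresheaf _ _).full, (fullyFaithfulSheafToPresheaf _ _).faithful⟩,
    ⟨ObjectProperty.lift _ (coconst C) hsheaf, ⟨Iso.refl _⟩⟩, sheafToSet hsheaf, rfl, ?_⟩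
  refine LocalGeometricMorphism.isQualityType_of_mem_essImage _ fun A => ?_
  have := (hI.topology.W_iff _).1
    (W_evCoconstAdj_unit_const hpoint (J := hI.topology) (fun X S hS => hS) A)
  exact ⟨A, ⟨((sheafificationIso ⟨_, hsheaf A⟩) ≪≫
    (asIso ((presheafToSheaf hI.topology (Type u)).map
      ((evCoconstAdj C).unit.app ((Functor.const Cᵒᵖ).obj A)))).symm)⟩⟩

/-- The sieve of all maps in an idempotent ideal with codomain `X`. -/
def IsIdempotentIdeal.sieve {C : Type u} [Category.{v} C] {I : MorphismProperty C}
    (hI : IsIdempotentIdeal I) (X : C) : Sieve X where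
  arrows _ f := I f
  downward_closed hf g := hI.precomp g _ hf

namespace GeometricMorphism

variable {D : Type u₁} [Category.{v₁} D] {E : Type u₂} [Category.{v₂} E]

/-- An object `k_* d` is local with respect to the maps inverted by `k^*`. -/
theorem existsUnique_extension (k : GeometricMorphism D E) {P Q : E} (g : P ⟶ Q)
    [IsIso (k.inverse.map g)] {d : D} (f : P ⟶ k.direct.obj d) : ∃! f', g ≫ f' = f := by
  refine ⟨k.adj.homEquiv _ _ (inv (k.inverse.map g) ≫ (k.adj.homEquiv _ _).symm f), ?_, ?_⟩
  · simp [← Adjunction.homEquiv_naturality_left]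
  · rintro f' rfl
    simp [Adjunction.homEquiv_naturality_left_symm]

end GeometricMorphism

/-- The isomorphism `q^* ≅ q^!` of a quality type. -/
noncomputable def LocalGeometricMorphism.inverseIsoCoinverse {E : Type u₁} [Category.{v₁} E]
    {S : Type u₂} [Category.{v₂} S] (q : LocalGeometricMorphism E S) (hq : q.IsQualityType) :
    q.inverse ≅ q.coinverse :=
  have : IsIso q.phi := hq
  asIso q.phi

section

variable {C : Type u} [SmallCategory C] [HasTerminal C]

/-- A map of presheaves that is inverted by a subtopos above the centre is bijective on global
sections. -/
theorem isIso_evaluation_map_of_isAbove_centre {D : Type u₁} [Category.{v₁} D]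
    {k : GeometricMorphism D (Cᵒᵖ ⥤ Type u)} (hk : k.IsSubtopos)
    (hc : k.IsAbove (presheafToSet C).centre) {P Q : Cᵒᵖ ⥤ Type u} (g : P ⟶ Q)
    [IsIso (k.inverse.map g)] : IsIso (((evaluation Cᵒᵖ (Type u)).obj (op (⊤_ C))).map g) := by
  have := hk.full
  have := hk.faithful
  obtain ⟨h, ⟨i⟩⟩ := hc
  have adj : k.direct ⋙ (evaluation Cᵒᵖ (Type u)).obj (op (⊤_ C)) ⊣ h :=
    (evCoconstAdj C).restrictFullyFaithful (Functor.FullyFaithful.ofFullyFaithful k.direct)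
      (Functor.FullyFaithful.id _) (Iso.refl _) i.symm
  let e := ((k.adj.comp adj).ofNatIsoRight i).leftAdjointUniq (evCoconstAdj C)
  rw [← NatIso.isIso_map_iff e]
  dsimp only [Functor.comp_map]
  infer_instance

/-- A subquality inverts the unit `p^* A ⟶ p^! A`. -/
theorem isIso_inverse_map_unit_const {D : Type u₁} [Category.{v₁} D]
    {k : GeometricMorphism D (Cᵒᵖ ⥤ Type u)} (hk : IsSubquality (presheafToSet C) k) (A : Type u) :
    IsIso (k.inverse.map ((evCoconstAdj C).unit.app ((Functor.const Cᵒᵖ).obj A))) := by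
  obtain ⟨hsub, hc, q, hq, hqt⟩ := hk
  have := hsub.full
  have := hsub.faithful
  obtain ⟨h, ⟨i⟩⟩ := id hc
  obtain ⟨B, ⟨θ⟩⟩ : ∃ B, Nonempty (k.inverse.obj ((Functor.const Cᵒᵖ).obj A) ≅ h.obj B) := by
    have adj : k.direct ⋙ (evaluation Cᵒᵖ (Type u)).obj (op (⊤_ C)) ⊣ h :=
      (evCoconstAdj C).restrictFullyFaithful (Functor.FullyFaithful.ofFullyFaithful k.direct)
        (Functor.FullyFaithful.id _) (Iso.refl _) i.symm
    obtain ⟨q, r, radj, hfull, hfaith⟩ := q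
    dsimp only at hq
    subst hq
    let q : LocalGeometricMorphism D (Type u) :=
      ⟨k.comp (presheafToSet C).toGeometricMorphism, r, radj, hfull, hfaith⟩
    exact ⟨A, ⟨(q.inverseIsoCoinverse hqt).app A ≪≫ (radj.rightAdjointUniq adj).app A⟩⟩
  let ψ : k.direct.obj (k.inverse.obj ((Functor.const Cᵒᵖ).obj A)) ≅ (coconst C).obj B :=
    k.direct.mapIso θ ≪≫ i.app B
  let e : (Functor.const Cᵒᵖ).obj A ⟶ (coconst C).obj B := k.adj.unit.app _ ≫ ψ.hom
  have he : IsIso (k.inverse.map e) := by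
    have : IsIso (k.inverse.map (k.adj.unit.app ((Functor.const Cᵒᵖ).obj A))) := inferInstance
    have : IsIso (k.inverse.map ψ.hom) := inferInstance
    exact (k.inverse.map_comp _ _).symm ▸ IsIso.comp_isIso
  have := isIso_evaluation_map_of_isAbove_centre hsub hc e
  have := isIso_evCoconstAdj_counit C
  have hu : IsIso (((evCoconstAdj C).homEquiv _ _).symm e) := by
    rw [Adjunction.homEquiv_counit]
    infer_instance
  have heq := ((evCoconstAdj C).homEquiv _ _).apply_symm_apply e
  rw [Adjunction.homEquiv_unit] at heq
  rw [← heq, Functor.map_comp] at he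
  exact IsIso.of_isIso_comp_right _ (k.inverse.map ((coconst C).map
    (((evCoconstAdj C).homEquiv _ _).symm e)))

/-- The pseudo-constants with codomain `X` are the pullback of the constant families of points
of `X`. -/
theorem exists_isPullback_sieve (hpoint : ∀ X : C, Nonempty (⊤_ C ⟶ X))
    (hI : IsIdempotentIdeal (pseudoConstants C)) (X : C) :
    ∃ t, IsPullback (hI.sieve X).functorInclusion t ((evCoconstAdj C).unit.app (yoneda.obj X))
      ((evCoconstAdj C).unit.app ((Functor.const Cᵒᵖ).obj (⊤_ C ⟶ X))) := by
  refine ⟨{ app := fun Y => ↾fun f => (hpoint Y.unop).some ≫ f.1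
            naturality := fun Y Z g => ?_ }, ?_⟩
  · ext f
    exact (Category.assoc _ _ _).symm.trans (f.2 _ _)
  · refine IsPullback.of_forall_isPullback_app fun Y => ?_
    rw [Types.isPullback_iff]
    refine ⟨?_, ?_, ?_⟩
    · ext f
      funext a
      exact f.2 _ _
    · rintro f g ⟨h, -⟩
      exact Subtype.ext h
    · intro f a h
      have h' (b : ⊤_ C ⟶ Y.unop) : b ≫ f = a := congrFun h b
      exact ⟨⟨f, fun b c => (h' b).trans (h' c).symm⟩, rfl, h' _⟩

/-- A subquality inverts the inclusions of covering sieves. -/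
theorem isIso_inverse_map_functorInclusion (hpoint : ∀ X : C, Nonempty (⊤_ C ⟶ X))
    (hI : IsIdempotentIdeal (pseudoConstants C)) {D : Type u₁} [Category.{v₁} D]
    {k : GeometricMorphism D (Cᵒᵖ ⥤ Type u)} (hk : IsSubquality (presheafToSet C) k)
    {X : C} (S : Sieve X) (hS : S ∈ hI.topology X) :
    IsIso (k.inverse.map S.functorInclusion) := by
  have := k.lex
  have := isIso_inverse_map_unit_const hk (⊤_ C ⟶ X)
  obtain ⟨t, ht⟩ := exists_isPullback_sieve hpoint hI X
  have hiso : IsIso (k.inverse.map (hI.sieve X).functorInclusion) :=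
    (ht.map k.inverse).isIso_fst_of_isIso
  have hle : hI.sieve X ≤ S := fun Y f hf => hS f hf
  rw [← Sieve.natTransOfLe_comm hle, Functor.map_comp] at hiso
  have : IsSplitEpi (k.inverse.map S.functorInclusion) :=
    ⟨⟨⟨inv (k.inverse.map (Sieve.natTransOfLe hle) ≫ k.inverse.map S.functorInclusion) ≫
      k.inverse.map (Sieve.natTransOfLe hle), by simp⟩⟩⟩
  exact isIso_of_mono_of_isSplitEpi _

theorem isAbove_of_isSubquality (hpoint : ∀ X : C, Nonempty (⊤_ C ⟶ X))
    (hI : IsIdempotentIdeal (pseudoConstants C)) {D : Type u₁} [Category.{v₁} D]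
    {k : GeometricMorphism D (Cᵒᵖ ⥤ Type u)} (hk : IsSubquality (presheafToSet C) k) :
    (sheafSubtopos hI.topology).IsAbove k := by
  have hsheaf (d : D) : Presheaf.IsSheaf hI.topology (k.direct.obj d) := by
    rw [isSheaf_iff_isSheaf_of_type]
    intro X S hS
    rw [Presieve.isSheafFor_iff_yonedaSheafCondition]
    intro f
    have := isIso_inverse_map_functorInclusion hpoint hI hk S hS
    exact k.existsUnique_extension S.functorInclusion f
  exact ⟨ObjectProperty.lift _ k.direct hsheaf, ⟨Iso.refl _⟩⟩

end

namespace IsIdempotentIdeal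

variable {C : Type u} [SmallCategory C] {I : MorphismProperty C} (hI : IsIdempotentIdeal I)

/-- The functor `X ↦ I(-, X)` of an idempotent ideal `I`. -/
def sieveFunctor : C ⥤ Cᵒᵖ ⥤ Type u where
  obj X := (hI.sieve X).functor
  map g :=
    { app := fun Y => ↾fun f => ⟨f.1 ≫ g, hI.postcomp f.1 g f.2⟩
      naturality := fun Y Z h => by
        ext f
        exact Subtype.ext (Category.assoc _ _ _) }
  map_id X := by
    ext Y f
    exact Subtype.ext (Category.comp_id _)
  map_comp g h := by
    ext Y f
    exact Subtype.ext (Category.assoc _ _ _).symm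

/-- The functor `P ↦ (X ↦ Hom(I(-, X), P))`. -/
abbrev homFunctor : (Cᵒᵖ ⥤ Type u) ⥤ Cᵒᵖ ⥤ Type u :=
  Presheaf.restrictedULiftYoneda.{u} hI.sieveFunctor

theorem isRightAdjoint_homFunctor : hI.homFunctor.IsRightAdjoint :=
  (Presheaf.uliftYonedaAdjunction.{u} _
    (uliftYoneda.{u}.leftKanExtensionUnit hI.sieveFunctor)).isRightAdjoint

variable {hI}

/-- The value at `f : Y ⟶ X` in `I` of an element of `Hom(I(-, X), P)`. -/
def value {P : Cᵒᵖ ⥤ Type u} {X : C} (σ : (hI.homFunctor.obj P).obj (op X)) {Y : C}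
    (f : Y ⟶ X) (hf : I f) : P.obj (op Y) :=
  σ.down.app (op Y) ⟨f, hf⟩

theorem value_ext {P : Cᵒᵖ ⥤ Type u} {X : C} {σ τ : (hI.homFunctor.obj P).obj (op X)}
    (h : ∀ ⦃Y : C⦄ (f : Y ⟶ X) (hf : I f), value σ f hf = value τ f hf) : σ = τ := by
  refine ULift.ext _ _ (NatTrans.ext (funext fun Y => ConcreteCategory.hom_ext _ _ fun f => ?_))
  exact h f.1 f.2

theorem value_map {P : Cᵒᵖ ⥤ Type u} {X X' : C} (σ : (hI.homFunctor.obj P).obj (op X))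
    (g : X' ⟶ X) {Y : C} (f : Y ⟶ X') (hf : I f) :
    value ((hI.homFunctor.obj P).map g.op σ) f hf = value σ (f ≫ g) (hI.postcomp f g hf) :=
  rfl

theorem map_value {P : Cᵒᵖ ⥤ Type u} {X : C} (σ : (hI.homFunctor.obj P).obj (op X))
    {Y Z : C} (f : Y ⟶ X) (hf : I f) (u : Z ⟶ Y) :
    P.map u.op (value σ f hf) = value σ (u ≫ f) (hI.precomp u f hf) :=
  (NatTrans.naturality_apply σ.down u.op _).symm

/-- The element of `Hom(I(-, X), P)` with given values. -/
def ofValues {P : Cᵒᵖ ⥤ Type u} {X : C} (v : ∀ ⦃Y : C⦄ (f : Y ⟶ X), I f → P.obj (op Y))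
    (hv : ∀ ⦃Y Z : C⦄ (u : Z ⟶ Y) (f : Y ⟶ X) (hf : I f),
      P.map u.op (v f hf) = v (u ≫ f) (hI.precomp u f hf)) :
    (hI.homFunctor.obj P).obj (op X) :=
  ⟨{ app := fun Y => ↾fun f => v f.1 f.2
     naturality := fun Y Z g => by
      ext f
      exact (hv g.unop f.1 f.2).symm }⟩

variable (hI)

/-- The canonical map `P ⟶ Hom(I, P)`. -/
def toHomFunctor : 𝟭 (Cᵒᵖ ⥤ Type u) ⟶ hI.homFunctor where
  app P :=
    { app := fun X => ↾fun x => ofValues (hI := hI) (X := X.unop) (fun Y f _ => P.map f.op x)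
        (fun Y Z u f _ => by simp)
      naturality := fun X Y g => by
        ext x
        exact value_ext fun Z f hf =>
          (ConcreteCategory.congr_hom (P.map_comp g f.op) x).symm }
  naturality P Q g := by
    ext X x
    exact value_ext fun Z f hf => (NatTrans.naturality_apply g f.op x).symm

theorem W_toHomFunctor_app (P : Cᵒᵖ ⥤ Type u) : hI.topology.W (hI.toHomFunctor.app P) := by
  rw [hI.topology.W_iff_isLocallyBijective]
  refine ⟨⟨fun {X} x y h Y f hf => ?_⟩, ⟨fun {X} σ Y f hf => ⟨value σ f hf, ?_⟩⟩⟩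
  · exact congrArg (fun σ => value σ f hf) h
  · exact value_ext fun Z g hg => map_value σ f hf g

theorem value_eq_of_map_eq {P : Cᵒᵖ ⥤ Type u} {X : C} {σ τ : (hI.homFunctor.obj P).obj (op X)}
    (h : ∀ ⦃Y : C⦄ (f : Y ⟶ X), I f →
      (hI.homFunctor.obj P).map f.op σ = (hI.homFunctor.obj P).map f.op τ) : σ = τ := by
  refine value_ext fun Y f hf => ?_
  obtain ⟨Z, f₁, f₂, h₁, h₂, rfl⟩ := hI.idempotent f hf
  exact congrArg (fun σ => value σ f₁ h₁) (h f₂ h₂)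

/-- `Hom(I, P)` is a sheaf if `P` is separated. -/
theorem isSheaf_homFunctor_obj {P : Cᵒᵖ ⥤ Type u}
    (hP : ∀ ⦃X : C⦄ (x y : P.obj (op X)),
      (∀ ⦃Y : C⦄ (f : Y ⟶ X), I f → P.map f.op x = P.map f.op y) → x = y) :
    Presheaf.IsSheaf hI.topology (hI.homFunctor.obj P) := by
  rw [isSheaf_iff_isSheaf_of_type]
  intro X S hS x hx
  have hx' := hx.to_sieveCompatible
  have hval {Y Z W : C} (f : Y ⟶ X) (hf : S f) (u : Z ⟶ Y) (k : W ⟶ Z) (hk : I k) :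
      value (x (u ≫ f) (S.downward_closed hf u)) k hk = value (x f hf) (k ≫ u)
        (hI.postcomp k u hk) :=
    congrArg (fun σ => value σ k hk) (hx' f u hf)
  have hex {Y : C} (f : Y ⟶ X) (hf : I f) : ∃ y : P.obj (op Y), ∀ ⦃Z : C⦄ (k : Z ⟶ Y) (hk : I k),
      P.map k.op y = value (x f (hS f hf)) k hk := by
    obtain ⟨Z, f₁, f₂, h₁, h₂, rfl⟩ := hI.idempotent f hf
    refine ⟨value (x f₂ (hS f₂ h₂)) f₁ h₁, fun W k hk => ?_⟩
    rw [map_value, hval f₂ (hS f₂ h₂) f₁ k hk]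
  choose v hv using @hex
  refine ⟨ofValues (fun Y f hf => v f hf) fun Y Z u f hf => ?_, fun Y f hf => ?_,
    fun τ hτ => value_ext fun Y f hf => ?_⟩
  · refine hP _ _ fun W k hk => ?_
    refine Eq.trans ?_ (hv (u ≫ f) (hI.precomp u f hf) k hk).symm
    rw [hval f (hS f hf) u k hk, ← hv f hf (k ≫ u)]
    exact (ConcreteCategory.congr_hom (P.map_comp u.op k.op) (v f hf)).symm
  · refine value_ext fun Z g hg => hP _ _ fun W k hk => ?_
    refine (hv (g ≫ f) (hI.postcomp g f hg) k hk).trans ?_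
    rw [hval f hf g k hk, map_value]
  · refine hP _ _ fun W k hk => ?_
    refine Eq.trans ?_ (hv f hf k hk).symm
    rw [map_value, ← hτ f (hS f hf), value_map]

/-- The sheaf `Hom(I, Hom(I, P))` associated to a presheaf `P`. -/
def sheafification : (Cᵒᵖ ⥤ Type u) ⥤ Sheaf hI.topology (Type u) :=
  ObjectProperty.lift _ (hI.homFunctor ⋙ hI.homFunctor) fun _ =>
    hI.isSheaf_homFunctor_obj fun _ _ _ h => hI.value_eq_of_map_eq h

/-- `Hom(I, Hom(I, -))` is the sheafification functor. -/
noncomputable def presheafToSheafIso : presheafToSheaf hI.topology (Type u) ≅ hI.sheafification := by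
  let η : 𝟭 (Cᵒᵖ ⥤ Type u) ⟶ hI.sheafification ⋙ sheafToPresheaf _ _ :=
    hI.toHomFunctor ≫ Functor.whiskerLeft hI.homFunctor hI.toHomFunctor
  have hη (P : Cᵒᵖ ⥤ Type u) : IsIso ((presheafToSheaf hI.topology (Type u)).map (η.app P)) := by
    rw [← GrothendieckTopology.W_iff]
    exact hI.topology.W.comp_mem _ _ (hI.W_toHomFunctor_app P) (hI.W_toHomFunctor_app _)
  have : IsIso (Functor.whiskerRight η (presheafToSheaf hI.topology (Type u))) :=
    have (P : Cᵒᵖ ⥤ Type u) :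
      IsIso ((Functor.whiskerRight η (presheafToSheaf hI.topology (Type u))).app P) := hη P
    NatIso.isIso_of_isIso_app _
  exact (Functor.leftUnitor _).symm ≪≫
    asIso (Functor.whiskerRight η (presheafToSheaf hI.topology (Type u))) ≪≫
    Functor.associator _ _ _ ≪≫
    Functor.isoWhiskerLeft _ (sheafificationNatIso hI.topology (Type u)).symm ≪≫
    Functor.rightUnitor _

theorem isRightAdjoint_sheafification : hI.sheafification.IsRightAdjoint := by
  have := hI.isRightAdjoint_homFunctor
  exact ((Adjunction.ofIsRightAdjoint (hI.homFunctor ⋙ hI.homFunctor)).restrictFullyFaithful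
    (fullyFaithfulSheafToPresheaf hI.topology (Type u)) (Functor.FullyFaithful.id _)
    (L := sheafToPresheaf _ _ ⋙ (hI.homFunctor ⋙ hI.homFunctor).leftAdjoint)
    (R := hI.sheafification) (Iso.refl _) (Iso.refl _)).isRightAdjoint

theorem isEssential_sheafSubtopos : (sheafSubtopos hI.topology).IsEssential := by
  have := hI.isRightAdjoint_sheafification
  exact Functor.isRightAdjoint_of_iso hI.presheafToSheafIso.symm

end IsIdempotentIdeal

end LevelEpsilon

theorem mainTheorem4 {C : Type u} [SmallCategory C] [HasTerminal C]
    (hpoint : ∀ X : C, Nonempty (⊤_ C ⟶ X))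
    (hI : LevelEpsilon.IsIdempotentIdeal (LevelEpsilon.pseudoConstants C)) :
    (LevelEpsilon.presheafToSet C).IsPreCohesive ∧
    LevelEpsilon.IsLevelEpsilon.{w, v} (LevelEpsilon.presheafToSet C)
      (LevelEpsilon.sheafSubtopos hI.topology) ∧
    LevelEpsilon.IsLargestSubquality.{w, v} (LevelEpsilon.presheafToSet C)
      (LevelEpsilon.sheafSubtopos hI.topology) := by
  have h := LevelEpsilon.isSubquality_sheafSubtopos hpoint hI
  exact ⟨LevelEpsilon.isPreCohesive_presheafToSet hpoint,
    ⟨h, hI.isEssential_sheafSubtopos,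
      fun _ hk _ => LevelEpsilon.isAbove_of_isSubquality hpoint hI hk⟩,
    ⟨h, fun _ hk => LevelEpsilon.isAbove_of_isSubquality hpoint hI hk⟩⟩
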